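/- A composition is a finite sequence $\kappa=(\kappa_1,\dots,\kappa_\ell)$ of positive integers ($\ell=\ell(\kappa)\ge 0$, the empty composition allowed), with $|\kappa|=\kappa_1+\cdots+\kappa_\ell$. Let $\mathscr{C}^{(1)}$ be the set of compositions with $\kappa_{i+1}-\kappa_i\le 1$ for $1\le i<\ell(\kappa)$, and let $\sigma\mathscr{C}^{(1)}$ be the set obtained by adding $1$ to every part of each of them; equivalently, the set of $\kappa\in\mathscr{C}^{(1)}$ all of whose parts are at least $2$. Identify $\kappa$ with the word $X_\kappa=X_{\kappa_1}\cdots X_{\kappa_\ell}$ in noncommuting variables $X_0,X_1,X_2,\dots$. For a set $L$ of such words put $L=\sum_{\kappa\in L}X_\kappa$ and $L^g=\sum_{\kappa\in L}(-1)^{\ell(\kappa)}X_\kappa$, and for a noncommutative series $S$ let $S(z,q)$ be the result of substituting $X_k\mapsto zq^k$ for all $k$. Then, as formal power series in $q$ over any commutative ring (in particular over $\mathbb{Z}$ or a field of characteristic zero), all sums and products below converge coefficientwise and $$\mathscr{C}^{(1)}(-1,q)=(\mathscr{C}^{(1)})^{g}(1,q)=1+\sum_{\emptyset\ne\kappa\in\mathscr{C}^{(1)}}(-1)^{\ell(\kappa)}q^{|\kappa|}=\prod_{k=0}^{\infty}(1-q^{5k+1})(1-q^{5k+4}),$$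 $$(\sigma\mathscr{C}^{(1)})(-1,q)=(\sigma\mathscr{C}^{(1)})^{g}(1,q)=1+\sum_{\substack{\emptyset\ne\kappa\in\mathscr{C}^{(1)}\\ \kappa_i\ge 2\ \forall i}}(-1)^{\ell(\kappa)}q^{|\kappa|}=\prod_{k=0}^{\infty}(1-q^{5k+2})(1-q^{5k+3}).$$ -/

import Mathlib

open scoped PowerSeries PowerSeries.WithPiTopology

/-- Noncommutative formal power series over `R` in the letters `X_0, X_1, X_2, …`: functions from
words to `R`, where the word `X_{κ₁} X_{κ₂} ⋯ X_{κ_m}` is the list `[κ₁, κ₂, …, κ_m]`. -/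
abbrev NCSeries (R : Type*) : Type _ := List ℕ → R

/-- Compositions (finite, possibly empty, lists of positive integers) with risings at most `m`:
`κ_{i+1} - κ_i ≤ m` for all `i`. -/
def risingCompositions (m : ℕ) : Language ℕ :=
  {κ : List ℕ | (∀ k ∈ κ, 1 ≤ k) ∧ κ.IsChain (fun a b => (b : ℤ) - (a : ℤ) ≤ (m : ℤ))}

/-- The shift `σ` on languages, induced by `X_i ↦ X_{i+1}`. -/
def shiftLanguage (L : Language ℕ) : Language ℕ :=
  Language.map (fun i : ℕ => i + 1) L

open Classical in
/-- The generating series `∑_{ω ∈ L} ω`. -/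
noncomputable def genSeries (R : Type*) [CommRing R] (L : Language ℕ) : NCSeries R :=
  fun ω => if ω ∈ L then 1 else 0

open Classical in
/-- The graded generating series `∑_{ω ∈ L} (-1)^{ℓ(ω)} ω`. -/
noncomputable def gradedSeries (R : Type*) [CommRing R] (L : Language ℕ) : NCSeries R :=
  fun ω => if ω ∈ L then (-1) ^ ω.length else 0

/-- The term `⟨S, ω⟩ ω` of the series `S` after the substitution `X_k ↦ c q^k`. -/
noncomputable def umbralTerm {R : Type*} [CommRing R] (S : NCSeries R) (c : R)
    (ω : List ℕ) : R⟦X⟧ :=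
  S ω • (ω.map (fun k => PowerSeries.C c * (PowerSeries.X : R⟦X⟧) ^ k)).prod

/-- The `q`-umbral evaluation `S(c, q)`: the sum of all terms after the substitution
`X_k ↦ c q^k`, in the topology of coefficientwise convergence
(meaningful when `umbralTerm S c` is summable). -/
noncomputable def umbralEval {R : Type*} [CommRing R] [TopologicalSpace R]
    (S : NCSeries R) (c : R) : R⟦X⟧ :=
  ∑' ω : List ℕ, umbralTerm S c ω

/-- The signed monomial `(-1)^{ℓ(κ)} q^{|κ|}`. -/
noncomputable def signedMonomial (R : Type*) [CommRing R] (κ : List ℕ) : R⟦X⟧ :=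
  (-1) ^ κ.length * (PowerSeries.X : R⟦X⟧) ^ κ.sum

/-- The factor `(1 - q^{5k+a}) (1 - q^{5k+b})`. -/
noncomputable def rrFactor (R : Type*) [CommRing R] (a b k : ℕ) : R⟦X⟧ :=
  (1 - (PowerSeries.X : R⟦X⟧) ^ (5 * k + a)) * (1 - (PowerSeries.X : R⟦X⟧) ^ (5 * k + b))

/-! Let `F_a` be the signed series of the admissible words (letters at least `p`) that are empty or
begin with a letter at most `a`. Words beginning with exactly `a+1` contribute `-q^(a+1) F_(a+2)`,
so `F_a = F_(a+1) + q^(a+1) F_(a+2)` for `a ≥ p-1`. Moreover `F_(p-1) = 1`, and `F_a` tends to the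
wanted series `F`.

Put `P_n = ∏_{i>n} (1 - q^i)`. Then `P_n F_n` satisfies a second-order recurrence that expresses the
value at `n` through those at `n+1` and `n+2`. Selberg's series `K_n = selbergSeries R 0 2 n`
satisfies the same one. As `P_n F_n → F` and `K_n → 1`, the difference `P_n F_n - F K_n` tends to
zero, and running the recurrence from infinity makes it vanish (`tprod_mul_slowSeriesLE`). At `n =
p-1` this reads `P_(p-1) = F K_(p-1)`.

For `p = 1` and `p = 2` the Selberg series reduce to theta series at base point `q`, which the
triple product evaluates. Cancelling from `P_0`, split by residues mod 5, leaves the stated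
products. -/

open PowerSeries Filter Topology

/-! ### Gaussian binomials over a commutative ring, without division -/

section QBinomial

variable {A : Type*} [CommRing A]

/-- The Gaussian binomial coefficient `[n, k]` evaluated at `y`. -/
def gaussBinom (y : A) : ℕ → ℕ → A
  | _, 0 => 1
  | 0, _ + 1 => 0
  | n + 1, k + 1 => gaussBinom y n k + y ^ (k + 1) * gaussBinom y n (k + 1)

@[simp] lemma gaussBinom_zero_right (y : A) (n : ℕ) : gaussBinom y n 0 = 1 := by
  cases n <;> rfl

@[simp] lemma gaussBinom_zero_succ (y : A) (k : ℕ) : gaussBinom y 0 (k + 1) = 0 := rfl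

lemma gaussBinom_succ_succ (y : A) (n k : ℕ) :
    gaussBinom y (n + 1) (k + 1) = gaussBinom y n k + y ^ (k + 1) * gaussBinom y n (k + 1) := rfl

lemma gaussBinom_eq_zero_of_lt (y : A) {n k : ℕ} (h : n < k) : gaussBinom y n k = 0 := by
  induction n generalizing k with
  | zero => obtain ⟨k, rfl⟩ := Nat.exists_eq_succ_of_ne_zero h.ne_bot; rfl
  | succ n ih =>
    obtain ⟨k, rfl⟩ := Nat.exists_eq_succ_of_ne_zero (Nat.ne_zero_of_lt h)
    rw [Nat.succ_eq_add_one, gaussBinom_succ_succ, ih (by omega), ih (by omega)]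
    simp

@[simp] lemma gaussBinom_self (y : A) (n : ℕ) : gaussBinom y n n = 1 := by
  induction n with
  | zero => rfl
  | succ n ih => rw [gaussBinom_succ_succ, ih, gaussBinom_eq_zero_of_lt y n.lt_succ_self]; simp

/-- The homogeneous `q`-binomial theorem. -/
theorem prod_add_mul_pow_eq_sum_gaussBinom (y u z : A) (M : ℕ) :
    ∏ k ∈ Finset.range M, (u + z * y ^ k) =
      ∑ k ∈ Finset.range (M + 1), y ^ (k.choose 2) * gaussBinom y M k * z ^ k * u ^ (M - k) := by
  induction M generalizing z with
  | zero => simp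
  | succ M ih =>
    have h : ∏ k ∈ Finset.range M, (u + z * y ^ (k + 1)) =
        ∏ k ∈ Finset.range M, (u + (z * y) * y ^ k) :=
      Finset.prod_congr rfl fun k _ => by ring
    rw [Finset.prod_range_succ', h, ih, Finset.sum_range_succ' _ (M + 1), pow_zero, mul_one,
      mul_add]
    have h1 : (∑ k ∈ Finset.range (M + 1),
        y ^ (k.choose 2) * gaussBinom y M k * (z * y) ^ k * u ^ (M - k)) * u =
        ∑ k ∈ Finset.range (M + 1), y ^ ((k + 1).choose 2) *
          (y ^ (k + 1) * gaussBinom y M (k + 1)) * z ^ (k + 1) * u ^ (M - k) + u ^ (M + 1) := by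
      rw [Finset.sum_range_succ', Finset.sum_range_succ _ M,
        gaussBinom_eq_zero_of_lt y M.lt_succ_self, add_mul, Finset.sum_mul]
      simp only [mul_zero, zero_mul, add_zero]
      congr 1
      · refine Finset.sum_congr rfl fun k hk => ?_
        obtain ⟨d, rfl⟩ := Nat.exists_eq_add_of_lt (Finset.mem_range.mp hk)
        rw [show k + d + 1 - (k + 1) = d by omega, show k + d + 1 - k = d + 1 by omega]
        ring
      · simp [pow_succ]
    rw [h1, Finset.sum_mul, add_right_comm, ← Finset.sum_add_distrib]
    congr 1
    · refine Finset.sum_congr rfl fun k _ => ?_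
      rw [gaussBinom_succ_succ, Nat.choose_succ_succ' k 1, Nat.choose_one_right,
        Nat.add_sub_add_right]
      ring
    · simp

/-- `(1 - y^{k+1}) [n, k+1] = (1 - y^{n-k}) [n, k]`, with `n = m + k`. -/
lemma one_sub_mul_gaussBinom_succ (y : A) (m k : ℕ) :
    (1 - y ^ (k + 1)) * gaussBinom y (m + k) (k + 1) = (1 - y ^ m) * gaussBinom y (m + k) k := by
  obtain ⟨n, hn⟩ : ∃ n, n = m + k := ⟨_, rfl⟩
  induction n generalizing m k with
  | zero =>
    obtain ⟨rfl, rfl⟩ : m = 0 ∧ k = 0 := by omega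
    simp
  | succ n ih =>
    rcases m with _ | m
    · simp [gaussBinom_eq_zero_of_lt y k.lt_succ_self]
    rcases k with _ | k
    · have := ih m 0 (by omega)
      simp only [add_zero, zero_add, gaussBinom_zero_right, pow_one, mul_one] at this ⊢
      rw [show gaussBinom y (m + 1) 1 = _ from gaussBinom_succ_succ y m 0]
      simp only [zero_add, gaussBinom_zero_right, pow_one]
      linear_combination y * this
    · have h1 := ih (m + 1) k (by omega)
      have h2 := ih m (k + 1) (by omega)
      rw [show m + 1 + k = m + (k + 1) by omega] at h1
      rw [show m + 1 + (k + 1) = m + (k + 1) + 1 by omega, gaussBinom_succ_succ,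
        gaussBinom_succ_succ]
      linear_combination h1 + y ^ (k + 2) * h2

/-- `(1 - y^{n+1}) [n, k] = (1 - y^{n+1-k}) [n+1, k]`, with `n = m + k`. -/
lemma one_sub_mul_gaussBinom_succ_left (y : A) (m k : ℕ) :
    (1 - y ^ (m + k + 1)) * gaussBinom y (m + k) k =
      (1 - y ^ (m + 1)) * gaussBinom y (m + k + 1) k := by
  rcases k with _ | k
  · simp
  · have h := one_sub_mul_gaussBinom_succ y (m + 1) k
    rw [show m + 1 + k = m + (k + 1) by omega] at h
    rw [gaussBinom_succ_succ]
    linear_combination h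

/-- The finite `q`-Pochhammer symbol `(y; y)_n`. -/
def qPoch (y : A) (n : ℕ) : A := ∏ i ∈ Finset.range n, (1 - y ^ (i + 1))

/-- Division-free form of the quotient formula for Gaussian binomials; it makes them computable
modulo powers of `X` in the triple product. -/
lemma gaussBinom_mul_qPoch (y : A) (m k : ℕ) :
    gaussBinom y (m + k) k * qPoch y k = ∏ i ∈ Finset.range k, (1 - y ^ (m + i + 1)) := by
  induction k with
  | zero => simp [qPoch]
  | succ k ih =>
    have h1 := one_sub_mul_gaussBinom_succ y (m + 1) k
    have h2 := one_sub_mul_gaussBinom_succ_left y m k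
    rw [show m + 1 + k = m + k + 1 by omega] at h1
    rw [Finset.prod_range_succ, ← ih, qPoch, Finset.prod_range_succ, ← qPoch, ← add_assoc]
    linear_combination qPoch y k * (h1 - h2)

end QBinomial

/-! ### Coefficientwise limits and congruences modulo powers of `X` -/

section Convergence

variable {R : Type*} [CommRing R]

lemma PowerSeries.eq_zero_of_forall_X_pow_dvd {f : R⟦X⟧} (h : ∀ N, (X : R⟦X⟧) ^ N ∣ f) :
    f = 0 := by
  ext d
  exact X_pow_dvd_iff.mp (h (d + 1)) d d.lt_succ_self

lemma X_pow_dvd_prod_sub_one {ι : Type*} {f : ι → R⟦X⟧} {M : ℕ} (s : Finset ι)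
    (h : ∀ i ∈ s, (X : R⟦X⟧) ^ M ∣ f i - 1) : (X : R⟦X⟧) ^ M ∣ ∏ i ∈ s, f i - 1 := by
  classical
  induction s using Finset.induction_on with
  | empty => simp
  | insert a s ha ih =>
    rw [Finset.prod_insert ha,
      show f a * ∏ i ∈ s, f i - 1 = (f a - 1) * ∏ i ∈ s, f i + (∏ i ∈ s, f i - 1) by ring]
    exact dvd_add (dvd_mul_of_dvd_left (h a (Finset.mem_insert_self _ _)) _)
      (ih fun i hi => h i (Finset.mem_insert_of_mem hi))

/-- A backward linear recurrence of order two has only the zero solution among sequences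
converging to zero. -/
lemma eq_zero_of_backward_recurrence {e a b : ℕ → R⟦X⟧} {n₀ : ℕ}
    (h : ∀ n, n₀ ≤ n → e n = a n * e (n + 1) + b n * e (n + 2))
    (hX : ∀ n, (X : R⟦X⟧) ^ n ∣ e n) {n : ℕ} (hn : n₀ ≤ n) : e n = 0 := by
  refine eq_zero_of_forall_X_pow_dvd fun M => ?_
  -- The recurrence only looks at larger indices, so divisibility by `X ^ M`, known for `n ≥ M`,
  -- descends; `k` bounds the number of descents.
  have key : ∀ k n, n₀ ≤ n → M ≤ n + k → (X : R⟦X⟧) ^ M ∣ e n := by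
    intro k
    induction k with
    | zero => exact fun n _ hM => (pow_dvd_pow _ hM).trans (hX n)
    | succ k ih =>
      intro n hn hM
      rw [h n hn]
      exact dvd_add (dvd_mul_of_dvd_right (ih _ (by omega) (by omega)) _)
        (dvd_mul_of_dvd_right (ih _ (by omega) (by omega)) _)
  exact key M n hn (by omega)

variable [TopologicalSpace R]

lemma summable_of_finite_coeff_ne_zero {ι : Type*} {f : ι → R⟦X⟧}
    (h : ∀ d, {i | coeff d (f i) ≠ 0}.Finite) : Summable f :=
  (WithPiTopology.summable_iff_summable_coeff R).mpr fun d => summable_of_hasFiniteSupport (h d)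

lemma summable_of_X_pow_dvd {f : ℕ → R⟦X⟧} (h : ∀ r, (X : R⟦X⟧) ^ r ∣ f r) : Summable f := by
  refine summable_of_finite_coeff_ne_zero fun d => (Set.finite_Iic d).subset fun r hr => ?_
  by_contra hlt
  exact hr (X_pow_dvd_iff.mp (h r) d (not_le.mp hlt))

lemma multipliable_one_sub_X_pow_of_lt {e : ℕ → ℕ} (he : ∀ k, k < e k) :
    Multipliable fun k => (1 : R⟦X⟧) - X ^ e k := by
  -- `order_X_pow` needs a nontrivial ring.
  cases subsingleton_or_nontrivial R
  · have : Subsingleton R⟦X⟧ := inferInstance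
    exact .of_subsingleton_cod
  simp_rw [sub_eq_add_neg]
  apply WithPiTopology.multipliable_one_add_of_tendsto_order_atTop_nhds_top
  simp_rw [order_neg, order_X_pow]
  exact ENat.tendsto_natCast_nhds_top.comp (tendsto_atTop_mono (fun k => (he k).le) tendsto_id)

lemma tendsto_zero_of_X_pow_dvd {f : ℕ → R⟦X⟧} (h : ∀ N, (X : R⟦X⟧) ^ N ∣ f N) :
    Tendsto f atTop (𝓝 0) := by
  rw [WithPiTopology.tendsto_iff_coeff_tendsto]
  intro d
  refine tendsto_const_nhds.congr' ?_
  filter_upwards [eventually_gt_atTop d] with N hN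
  rw [X_pow_dvd_iff.mp (h N) d hN, map_zero]

variable [DiscreteTopology R]

lemma isClosed_setOf_X_pow_dvd (M : ℕ) : IsClosed {g : R⟦X⟧ | (X : R⟦X⟧) ^ M ∣ g} := by
  simp only [X_pow_dvd_iff, Set.ofPred_forall]
  exact isClosed_iInter fun m => isClosed_iInter fun _ =>
    isClosed_eq (WithPiTopology.continuous_coeff R m) continuous_const

lemma X_pow_dvd_tsum {ι : Type*} {f : ι → R⟦X⟧} {M : ℕ} (h : ∀ i, (X : R⟦X⟧) ^ M ∣ f i) :
    (X : R⟦X⟧) ^ M ∣ ∑' i, f i := by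
  by_cases hf : Summable f
  · exact (isClosed_setOf_X_pow_dvd M).mem_of_tendsto hf.hasSum
      (Eventually.of_forall fun s => Finset.dvd_sum fun i _ => h i)
  · rw [tsum_eq_zero_of_not_summable hf]
    exact dvd_zero _

lemma X_pow_dvd_tprod_sub_one {ι : Type*} {f : ι → R⟦X⟧} {M : ℕ} (hf : Multipliable f)
    (h : ∀ i, (X : R⟦X⟧) ^ M ∣ f i - 1) : (X : R⟦X⟧) ^ M ∣ ∏' i, f i - 1 :=
  (isClosed_setOf_X_pow_dvd M).mem_of_tendsto (hf.hasProd.sub_const 1)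
    (Eventually.of_forall fun s => X_pow_dvd_prod_sub_one s fun i _ => h i)

/-- Two convergent sequences of power series that agree to increasing order have the same limit. -/
lemma eq_of_tendsto_of_X_pow_dvd_sub {f g : ℕ → R⟦X⟧} {a b : R⟦X⟧} (hf : Tendsto f atTop (𝓝 a))
    (hg : Tendsto g atTop (𝓝 b)) (h : ∀ N, (X : R⟦X⟧) ^ N ∣ f N - g N) : a = b :=
  sub_eq_zero.mp (tendsto_nhds_unique (hf.sub hg) (tendsto_zero_of_X_pow_dvd h))

/-- Shifting the index of one part of a split series is free when its initial term vanishes. Both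
functional equations of Selberg's series have this shape. -/
lemma tsum_eq_tsum_of_eq_add_shift {f g u v : ℕ → R⟦X⟧} (hu : Summable u) (hv : Summable v)
    (h0 : u 0 = 0) (hf : ∀ r, f r = u r + v r) (hg : ∀ r, g r = u (r + 1) + v r) :
    ∑' r, f r = ∑' r, g r := by
  have hu' : Summable fun r => u (r + 1) := (summable_nat_add_iff 1).mpr hu
  rw [tsum_congr hf, tsum_congr hg, hu.tsum_add hv, hu'.tsum_add hv, hu.tsum_eq_zero_add, h0,
    zero_add]

lemma constantCoeff_tprod_eq_one {f : ℕ → R⟦X⟧} (hf : Multipliable f)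
    (h : ∀ k, constantCoeff (f k) = 1) : constantCoeff (∏' k, f k) = 1 := by
  rw [hf.map_tprod (constantCoeff (R := R)) (WithPiTopology.continuous_constantCoeff R)]
  simp [h]

end Convergence

/-! ### Selberg's series and its functional equations -/

section Selberg

variable (R : Type*) [CommRing R]

/-- The numbers `r (5 r + 1) / 2`. -/
def rrExponent : ℕ → ℕ
  | 0 => 0
  | r + 1 => rrExponent r + (5 * r + 3)

lemma rrExponent_succ (r : ℕ) : rrExponent (r + 1) = rrExponent r + (5 * r + 3) := rfl

lemma rrExponent_eq (r : ℕ) : rrExponent r = 5 * r.choose 2 + 3 * r := by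
  induction r with
  | zero => rfl
  | succ r ih => rw [rrExponent_succ, ih, Nat.choose_succ_succ' r 1, Nat.choose_one_right]; ring

lemma le_rrExponent (r : ℕ) : r ≤ rrExponent r := by
  rw [rrExponent_eq]; omega

/-- The `r`-th term of Selberg's series with base point `q^{n+1}`. -/
noncomputable def selbergTerm (c m n r : ℕ) : R⟦X⟧ :=
  (-1) ^ r * X ^ (rrExponent r + 2 * n * r + c * r) * (1 - X ^ (m * (n + 1 + 2 * r))) *
    gaussBinom X (n + r) r

/-- Selberg's series at the base point `q^{n+1}`. -/
noncomputable def selbergSeries [TopologicalSpace R] (c m n : ℕ) : R⟦X⟧ :=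
  ∑' r, selbergTerm R c m n r

variable {R}

lemma neg_one_pow_mul_X_pow_mul_dvd {r e : ℕ} (h : r ≤ e) (f : R⟦X⟧) :
    (X : R⟦X⟧) ^ r ∣ (-1) ^ r * X ^ e * f :=
  ((pow_dvd_pow X h).mul_left _).mul_right f

lemma X_pow_dvd_selbergTerm (c m n r : ℕ) :
    (X : R⟦X⟧) ^ (r + 2 * n * r) ∣ selbergTerm R c m n r := by
  have := le_rrExponent r
  rw [selbergTerm, mul_assoc _ (1 - _)]
  exact ((pow_dvd_pow X (by omega)).mul_left _).mul_right _

lemma one_sub_mul_gaussBinom_shift (n r : ℕ) :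
    (1 - (X : R⟦X⟧) ^ (r + 1)) * gaussBinom X (n + (r + 1)) (r + 1) =
      (1 - X ^ (n + 1)) * gaussBinom X (n + 1 + r) r := by
  rw [show n + (r + 1) = n + 1 + r by omega]
  exact one_sub_mul_gaussBinom_succ X (n + 1) r

lemma one_sub_mul_gaussBinom_shift_left (n r : ℕ) :
    (1 - (X : R⟦X⟧) ^ (n + 1 + r)) * gaussBinom X (n + r) r =
      (1 - X ^ (n + 1)) * gaussBinom X (n + 1 + r) r := by
  rw [show n + 1 + r = n + r + 1 by omega]
  exact one_sub_mul_gaussBinom_succ_left X n r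

variable [TopologicalSpace R]

lemma summable_selbergTerm (c m n : ℕ) : Summable (selbergTerm R c m n) :=
  summable_of_X_pow_dvd fun r =>
    (pow_dvd_pow X (Nat.le_add_right r _)).trans (X_pow_dvd_selbergTerm c m n r)

variable [DiscreteTopology R]

/-- With `x = q^(n+1)`, split `1 - x q^(2r) = (1 - q^r) + q^r (1 - x q^r)`. Shifting the first part
by one index lets both parts absorb their factor into the Gaussian binomial of base `n+1`. -/
lemma selbergSeries_one_one (n : ℕ) :
    selbergSeries R 1 1 n = (1 - X ^ (n + 1)) * selbergSeries R 0 2 (n + 1) := by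
  rw [selbergSeries, selbergSeries, ← (summable_selbergTerm (R := R) 0 2 (n + 1)).tsum_mul_left]
  refine tsum_eq_tsum_of_eq_add_shift
    (u := fun r => (-1) ^ r * X ^ (rrExponent r + 2 * n * r + r) *
      ((1 - X ^ r) * gaussBinom X (n + r) r))
    (v := fun r => (-1) ^ r * X ^ (rrExponent r + 2 * n * r + 2 * r) *
      ((1 - X ^ (n + 1)) * gaussBinom X (n + 1 + r) r)) ?_ ?_ (by simp) ?_ ?_
  · exact summable_of_X_pow_dvd fun r => neg_one_pow_mul_X_pow_mul_dvd (by omega) _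
  · exact summable_of_X_pow_dvd fun r => neg_one_pow_mul_X_pow_mul_dvd (by omega) _
  · intro r
    rw [← one_sub_mul_gaussBinom_shift_left, selbergTerm]
    ring
  · intro r
    rw [one_sub_mul_gaussBinom_shift, selbergTerm, rrExponent_succ]
    ring

/-- The same mechanism, with `(1 - x² q^(4r)) - q^r (1 - x q^(2r)) = (1 - q^r) + x q^(3r) (1 - x
q^r)`. -/
lemma selbergSeries_zero_two_sub (n : ℕ) :
    selbergSeries R 0 2 n = selbergSeries R 1 1 n +
      X ^ (n + 1) * (1 - X ^ (n + 1)) * selbergSeries R 1 1 (n + 1) := by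
  rw [← sub_eq_iff_eq_add']
  simp only [selbergSeries]
  rw [← (summable_selbergTerm (R := R) 1 1 (n + 1)).tsum_mul_left,
    ← (summable_selbergTerm (R := R) 0 2 n).tsum_sub (summable_selbergTerm (R := R) 1 1 n)]
  refine tsum_eq_tsum_of_eq_add_shift
    (u := fun r => (-1) ^ r * X ^ (rrExponent r + 2 * n * r) *
      ((1 - X ^ r) * gaussBinom X (n + r) r))
    (v := fun r => (-1) ^ r * X ^ (rrExponent r + 2 * n * r + (n + 1 + 3 * r)) *
      ((1 - X ^ (n + 1)) * gaussBinom X (n + 1 + r) r)) ?_ ?_ (by simp) ?_ ?_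
  · exact summable_of_X_pow_dvd fun r =>
      neg_one_pow_mul_X_pow_mul_dvd ((le_rrExponent r).trans (Nat.le_add_right _ _)) _
  · exact summable_of_X_pow_dvd fun r => neg_one_pow_mul_X_pow_mul_dvd (by omega) _
  · intro r
    rw [← one_sub_mul_gaussBinom_shift_left, selbergTerm, selbergTerm]
    ring
  · intro r
    rw [one_sub_mul_gaussBinom_shift, selbergTerm, rrExponent_succ]
    ring

lemma X_pow_dvd_selbergSeries_sub_one (n : ℕ) :
    (X : R⟦X⟧) ^ n ∣ selbergSeries R 0 2 n - 1 := by
  rw [selbergSeries, (summable_selbergTerm (R := R) 0 2 n).tsum_eq_zero_add, add_sub_right_comm]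
  refine dvd_add ?_ (X_pow_dvd_tsum fun r => ?_)
  · rw [show selbergTerm R 0 2 n 0 - 1 = -X ^ (2 * (n + 1)) by simp [selbergTerm, rrExponent],
      dvd_neg]
    exact pow_dvd_pow X (by omega)
  · exact (pow_dvd_pow X (by nlinarith [Nat.zero_le (n * r)])).trans
      (X_pow_dvd_selbergTerm 0 2 n (r + 1))

end Selberg

/-! ### Triple product at modulus five, as a limit of Cauchy's finite form -/

section TripleProduct

variable {R : Type*} [CommRing R]

lemma choose_two_add (m n : ℕ) :
    (m + n).choose 2 = m.choose 2 + n.choose 2 + m * n := by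
  induction n with
  | zero => simp
  | succ n ih =>
    rw [← add_assoc, Nat.choose_succ_succ' (m + n) 1, Nat.choose_succ_succ' n 1, ih]
    simp only [Nat.choose_one_right]
    ring

/-- Cauchy's finite form of the triple product identity, before cancelling the power of `X`. -/
lemma X_pow_mul_prod_eq_sum_gaussBinom {a b : ℕ} (hab : a + b = 5) (N : ℕ) :
    (-1) ^ N * (X : R⟦X⟧) ^ (a * N + 5 * N.choose 2 + 5 * N * N) *
        ∏ k ∈ Finset.range N, ((1 - X ^ (5 * k + a)) * (1 - X ^ (5 * k + b))) =
      ∑ k ∈ Finset.range (2 * N + 1), (-1) ^ k *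
        X ^ (5 * k.choose 2 + a * k + 5 * N * (2 * N - k)) * gaussBinom (X ^ 5) (2 * N) k := by
  -- Taking `u = X^(5N)` instead of `1` avoids negative exponents in `z`; the surplus power of `X`
  -- is cancelled later.
  have h := prod_add_mul_pow_eq_sum_gaussBinom ((X : R⟦X⟧) ^ 5) (X ^ (5 * N)) (-X ^ a) (2 * N)
  have h1 : ∏ k ∈ Finset.range N, ((X : R⟦X⟧) ^ (5 * N) + -X ^ a * (X ^ 5) ^ k) =
      (-1) ^ N * X ^ (a * N + 5 * N.choose 2) * ∏ k ∈ Finset.range N, (1 - X ^ (5 * k + b)) := by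
    rw [← Finset.prod_range_reflect (fun k => (1 : R⟦X⟧) - X ^ (5 * k + b))]
    have : ((-1) ^ N * X ^ (a * N + 5 * N.choose 2) : R⟦X⟧) =
        ∏ k ∈ Finset.range N, -X ^ (a + 5 * k) := by
      rw [Finset.prod_neg, Finset.prod_pow_eq_pow_sum, Finset.card_range, Finset.sum_add_distrib,
        ← Finset.mul_sum, Finset.sum_range_id, Nat.choose_two_right]
      simp [mul_comm]
    rw [this, ← Finset.prod_mul_distrib]
    refine Finset.prod_congr rfl fun k hk => ?_
    have hk' := Finset.mem_range.mp hk
    rw [show 5 * N = (a + 5 * k) + (5 * (N - 1 - k) + b) by omega]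
    ring
  have h2 : ∏ k ∈ Finset.range N, ((X : R⟦X⟧) ^ (5 * N) + -X ^ a * (X ^ 5) ^ (N + k)) =
      X ^ (5 * N * N) * ∏ k ∈ Finset.range N, (1 - X ^ (5 * k + a)) := by
    rw [pow_mul X (5 * N) N]
    conv_rhs => rw [← Finset.card_range N, ← Finset.prod_const, Finset.card_range,
      ← Finset.prod_mul_distrib]
    refine Finset.prod_congr rfl fun k _ => ?_
    ring
  rw [two_mul, Finset.prod_range_add, h1, h2, ← two_mul] at h
  rw [Finset.prod_mul_distrib]
  refine Eq.trans ?_ (h.trans (Finset.sum_congr rfl fun k _ => ?_))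
  · ring
  · rw [neg_pow, ← pow_mul, ← pow_mul, ← pow_mul]
    ring

/-- Cauchy's finite form of the triple product identity. -/
lemma prod_eq_sum_gaussBinom {a b : ℕ} (hab : a + b = 5) (N : ℕ) :
    ∏ k ∈ Finset.range N, ((1 - (X : R⟦X⟧) ^ (5 * k + a)) * (1 - X ^ (5 * k + b))) =
      ∑ r ∈ Finset.range (N + 1), (-1) ^ r * X ^ (5 * r.choose 2 + a * r) *
          gaussBinom (X ^ 5) (2 * N) (N + r) -
      ∑ r ∈ Finset.range N, (-1) ^ r * X ^ (5 * (r + 1).choose 2 + b * (r + 1)) *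
          gaussBinom (X ^ 5) (2 * N) (N - 1 - r) := by
  have h := X_pow_mul_prod_eq_sum_gaussBinom (R := R) hab N
  -- Split at the central index `N` and reverse the lower half, so that both sums run outwards.
  rw [show 2 * N + 1 = N + (N + 1) by omega, Finset.sum_range_add,
    ← Finset.sum_range_reflect _ N] at h
  set c := a * N + 5 * N.choose 2 + 5 * N * N with hc
  have e1 : ∀ r ∈ Finset.range (N + 1), (-1) ^ (N + r) *
      (X : R⟦X⟧) ^ (5 * (N + r).choose 2 + a * (N + r) + 5 * N * (2 * N - (N + r))) *
        gaussBinom (X ^ 5) (2 * N) (N + r) = ((-1) ^ N * X ^ c) *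
      ((-1) ^ r * X ^ (5 * r.choose 2 + a * r) * gaussBinom (X ^ 5) (2 * N) (N + r)) := by
    intro r hr
    obtain ⟨d, hd⟩ := Nat.exists_eq_add_of_le (Finset.mem_range_succ_iff.mp hr)
    have : 5 * (N + r).choose 2 + a * (N + r) + 5 * N * (2 * N - (N + r)) =
        c + (5 * r.choose 2 + a * r) := by
      rw [choose_two_add, show 2 * N - (N + r) = d by omega, hc]
      zify at hd ⊢
      linear_combination -5 * (N : ℤ) * hd
    rw [this]
    ring
  have e2 : ∀ r ∈ Finset.range N, (-1) ^ (N - 1 - r) *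
      (X : R⟦X⟧) ^ (5 * (N - 1 - r).choose 2 + a * (N - 1 - r) +
        5 * N * (2 * N - (N - 1 - r))) *
        gaussBinom (X ^ 5) (2 * N) (N - 1 - r) = ((-1) ^ N * X ^ c) *
      -((-1) ^ r * X ^ (5 * (r + 1).choose 2 + b * (r + 1)) *
        gaussBinom (X ^ 5) (2 * N) (N - 1 - r)) := by
    intro r hr
    obtain ⟨d, hd⟩ := Nat.exists_eq_add_of_lt (Finset.mem_range.mp hr)
    have hd' : N - 1 - r = d := by omega
    have : 5 * d.choose 2 + a * d + 5 * N * (2 * N - d) =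
        c + (5 * (r + 1).choose 2 + b * (r + 1)) := by
      rw [hc, show 2 * N - d = N + (r + 1) by omega]
      obtain rfl : N = d + (r + 1) := by omega
      rw [choose_two_add]
      have hr : 5 * (r + 1) = (a + b) * (r + 1) := by rw [hab]
      have h2 : 2 * (r + 1).choose 2 = (r + 1) * r := by
        rw [Nat.choose_two_right, Nat.add_sub_cancel, mul_comm 2,
          Nat.div_mul_cancel (by rw [mul_comm]; exact (Nat.even_mul_succ_self r).two_dvd)]
      zify at hr h2 ⊢
      linear_combination hr - 5 * h2
    have hsign : ((-1) ^ d : R⟦X⟧) = -((-1) ^ N * (-1) ^ r) := by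
      rw [show N = d + r + 1 by omega, pow_succ, pow_add]
      rw [show ((-1) ^ d * (-1) ^ r * -1 * (-1) ^ r : R⟦X⟧) = -(-1) ^ d * ((-1) ^ r * (-1) ^ r) by
        ring, ← mul_pow]
      simp
    rw [hd', this, hsign]
    ring
  rw [Finset.sum_congr rfl e1, Finset.sum_congr rfl e2, ← Finset.mul_sum, ← Finset.mul_sum,
    ← mul_add, Finset.sum_neg_distrib] at h
  have hu : IsUnit ((-1) ^ N : R⟦X⟧) := isUnit_one.neg.pow N
  rw [mul_assoc, mul_assoc] at h
  rw [X_pow_mul_cancel (hu.mul_left_cancel h)]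
  ring

lemma X_pow_dvd_gaussBinom_mul_qPoch_sub_one (m k : ℕ) :
    (X : R⟦X⟧) ^ m ∣ gaussBinom (X ^ 5) (m + k) k * qPoch (X ^ 5) k - 1 := by
  rw [gaussBinom_mul_qPoch]
  refine X_pow_dvd_prod_sub_one _ fun i _ => ?_
  rw [sub_sub_cancel_left, dvd_neg, ← pow_mul]
  exact pow_dvd_pow X (by omega)

lemma X_pow_dvd_qPoch_sub {m n : ℕ} (h : m ≤ n) :
    (X : R⟦X⟧) ^ m ∣ qPoch ((X : R⟦X⟧) ^ 5) n - qPoch (X ^ 5) m := by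
  obtain ⟨d, rfl⟩ := Nat.exists_eq_add_of_le h
  rw [qPoch, qPoch, Finset.prod_range_add]
  rw [show ∀ x y : R⟦X⟧, x * y - x = x * (y - 1) by intros; ring]
  refine (X_pow_dvd_prod_sub_one _ fun i _ => ?_).mul_left _
  rw [sub_sub_cancel_left, dvd_neg, ← pow_mul]
  exact pow_dvd_pow X (by omega)

lemma X_pow_dvd_gaussBinom_mul_qPoch_sub_one_of_le {M m k N : ℕ} (hm : M ≤ m) (hk : M ≤ k)
    (hN : M ≤ N) :
    (X : R⟦X⟧) ^ M ∣ gaussBinom (X ^ 5) (m + k) k * qPoch (X ^ 5) N - 1 := by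
  have h1 := (pow_dvd_pow (X : R⟦X⟧) hm).trans (X_pow_dvd_gaussBinom_mul_qPoch_sub_one m k)
  have h2 := X_pow_dvd_qPoch_sub (R := R) hk
  have h3 := X_pow_dvd_qPoch_sub (R := R) hN
  rw [show gaussBinom ((X : R⟦X⟧) ^ 5) (m + k) k * qPoch (X ^ 5) N - 1 =
    (gaussBinom (X ^ 5) (m + k) k * qPoch (X ^ 5) k - 1) + gaussBinom (X ^ 5) (m + k) k *
      ((qPoch (X ^ 5) N - qPoch (X ^ 5) M) - (qPoch (X ^ 5) k - qPoch (X ^ 5) M)) by ring]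
  exact dvd_add h1 ((dvd_sub h3 h2).mul_left _)

/-- A truncated triple product identity. -/
lemma X_pow_dvd_qPoch_mul_prod_sub {a b : ℕ} (hab : a + b = 5) (ha : 1 ≤ a) (hb : 1 ≤ b) (N : ℕ) :
    (X : R⟦X⟧) ^ N ∣ qPoch (X ^ 5) N *
        ∏ k ∈ Finset.range N, ((1 - X ^ (5 * k + a)) * (1 - X ^ (5 * k + b))) -
      ∑ r ∈ Finset.range N, (-1) ^ r *
        (X ^ (5 * r.choose 2 + a * r) - X ^ (5 * (r + 1).choose 2 + b * (r + 1))) := by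
  rw [prod_eq_sum_gaussBinom hab, Finset.sum_range_succ]
  have hN : N ≤ 5 * N.choose 2 + a * N := by nlinarith [Nat.zero_le (N.choose 2)]
  -- The Gaussian factor is known only modulo `X^M`; the power `X^e` in front supplies the missing
  -- precision.
  have key : ∀ e M m k : ℕ, ∀ s : R⟦X⟧, M ≤ m → M ≤ k → M ≤ N → N ≤ e + M → m + k = 2 * N →
      (X : R⟦X⟧) ^ N ∣
        qPoch (X ^ 5) N * (s * X ^ e * gaussBinom (X ^ 5) (2 * N) k) - s * X ^ e := by
    intro e M m k s h1 h2 h3 h4 h5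
    rw [show qPoch ((X : R⟦X⟧) ^ 5) N * (s * X ^ e * gaussBinom (X ^ 5) (2 * N) k) - s * X ^ e =
      s * (X ^ e * (gaussBinom (X ^ 5) (2 * N) k * qPoch (X ^ 5) N - 1)) by ring, ← h5]
    refine Dvd.dvd.mul_left ((pow_dvd_pow X h4).trans ?_) _
    rw [pow_add]
    exact mul_dvd_mul_left _ (X_pow_dvd_gaussBinom_mul_qPoch_sub_one_of_le h1 h2 h3)
  have hsum1 : (X : R⟦X⟧) ^ N ∣ ∑ r ∈ Finset.range N,
      (qPoch (X ^ 5) N * ((-1) ^ r * X ^ (5 * r.choose 2 + a * r) *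
        gaussBinom (X ^ 5) (2 * N) (N + r)) - (-1) ^ r * X ^ (5 * r.choose 2 + a * r)) := by
    refine Finset.dvd_sum fun r hr => ?_
    have hr' := Finset.mem_range.mp hr
    refine key _ (N - r) (N - r) _ _ le_rfl (by omega) (by omega) ?_ (by omega)
    have : r ≤ a * r := Nat.le_mul_of_pos_left r ha
    omega
  have hsum2 : (X : R⟦X⟧) ^ N ∣ ∑ r ∈ Finset.range N,
      (qPoch (X ^ 5) N * ((-1) ^ r * X ^ (5 * (r + 1).choose 2 + b * (r + 1)) *
        gaussBinom (X ^ 5) (2 * N) (N - 1 - r)) -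
        (-1) ^ r * X ^ (5 * (r + 1).choose 2 + b * (r + 1))) := by
    refine Finset.dvd_sum fun r hr => ?_
    have hr' := Finset.mem_range.mp hr
    refine key _ (N - 1 - r) (N + 1 + r) _ _ (by omega) le_rfl (by omega) ?_ (by omega)
    have : r + 1 ≤ b * (r + 1) := Nat.le_mul_of_pos_left (r + 1) hb
    omega
  have hlast : (X : R⟦X⟧) ^ N ∣ qPoch (X ^ 5) N * ((-1) ^ N * X ^ (5 * N.choose 2 + a * N) *
      gaussBinom (X ^ 5) (2 * N) (N + N)) :=
    (((pow_dvd_pow X hN).mul_left _).mul_right _).mul_left _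
  convert dvd_add (dvd_sub hsum1 hsum2) hlast using 1
  simp only [Finset.sum_sub_distrib, mul_sub, ← Finset.mul_sum]
  ring

variable [TopologicalSpace R] [DiscreteTopology R]

/-- The Jacobi triple product identity at modulus five. -/
theorem tprod_mul_tprod_eq_tsum {a b : ℕ} (hab : a + b = 5) (ha : 1 ≤ a) (hb : 1 ≤ b) :
    (∏' k : ℕ, (1 - (X : R⟦X⟧) ^ (5 * k + 5))) *
        ∏' k : ℕ, ((1 - (X : R⟦X⟧) ^ (5 * k + a)) * (1 - X ^ (5 * k + b))) =
      ∑' r : ℕ, (-1) ^ r *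
        ((X : R⟦X⟧) ^ (5 * r.choose 2 + a * r) - X ^ (5 * (r + 1).choose 2 + b * (r + 1))) := by
  have m5 : Multipliable fun k : ℕ => (1 : R⟦X⟧) - X ^ (5 * k + 5) :=
    multipliable_one_sub_X_pow_of_lt fun k => by omega
  have mab : Multipliable fun k : ℕ => (1 - (X : R⟦X⟧) ^ (5 * k + a)) * (1 - X ^ (5 * k + b)) :=
    (multipliable_one_sub_X_pow_of_lt fun k => by omega).mul
      (multipliable_one_sub_X_pow_of_lt fun k => by omega)
  have hs : Summable fun r : ℕ => (-1) ^ r *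
      ((X : R⟦X⟧) ^ (5 * r.choose 2 + a * r) - X ^ (5 * (r + 1).choose 2 + b * (r + 1))) := by
    refine summable_of_X_pow_dvd fun r => Dvd.dvd.mul_left (dvd_sub ?_ ?_) _
    · exact pow_dvd_pow X ((Nat.le_mul_of_pos_left r ha).trans (Nat.le_add_left _ _))
    · exact pow_dvd_pow X ((Nat.le_succ r).trans
        ((Nat.le_mul_of_pos_left (r + 1) hb).trans (Nat.le_add_left _ _)))
  refine eq_of_tendsto_of_X_pow_dvd_sub
    (m5.tendsto_prod_tprod_nat.mul mab.tendsto_prod_tprod_nat) hs.tendsto_sum_tsum_nat fun N => ?_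
  have hq : ∏ k ∈ Finset.range N, (1 - (X : R⟦X⟧) ^ (5 * k + 5)) = qPoch (X ^ 5) N :=
    Finset.prod_congr rfl fun k _ => by rw [← pow_mul, mul_add, mul_one]
  rw [hq]
  exact X_pow_dvd_qPoch_mul_prod_sub hab ha hb N

end TripleProduct

/-! ### Signed series of words and their recurrence -/

section Words

variable (R : Type*) [CommRing R]

/-- Words with all letters at least `p` and all risings at most one. -/
def slowWords (p : ℕ) : Set (List ℕ) :=
  {κ | (∀ k ∈ κ, p ≤ k) ∧ κ.IsChain fun a b => b ≤ a + 1}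

/-- Words that are empty or begin with a letter at most `a`. -/
def headLE (a : ℕ) : Set (List ℕ) := {κ | ∀ y ∈ κ.head?, y ≤ a}

lemma nil_mem_slowWords (p : ℕ) : [] ∈ slowWords p := ⟨by simp, .nil⟩

lemma nil_mem_headLE (a : ℕ) : [] ∈ headLE a := by simp [headLE]

lemma cons_mem_slowWords {p a : ℕ} {κ : List ℕ} :
    a :: κ ∈ slowWords p ↔ p ≤ a ∧ κ ∈ slowWords p ∩ headLE (a + 1) := by
  simp only [slowWords, headLE, Set.mem_inter_iff, Set.mem_ofPred_eq, List.isChain_cons,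
    List.forall_mem_cons]
  tauto

lemma cons_mem_headLE {a b : ℕ} {κ : List ℕ} : b :: κ ∈ headLE a ↔ b ≤ a := by
  simp [headLE]

lemma finite_setOf_sum_eq (d : ℕ) : {κ : List ℕ | (∀ k ∈ κ, 1 ≤ k) ∧ κ.sum = d}.Finite :=
  (Set.finite_range (Composition.blocks : Composition d → List ℕ)).subset fun κ hκ =>
    ⟨⟨κ, fun hk => hκ.1 _ hk, hκ.2⟩, rfl⟩

lemma signedMonomial_nil : signedMonomial R [] = 1 := by simp [signedMonomial]

lemma signedMonomial_cons (a : ℕ) (κ : List ℕ) :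
    signedMonomial R (a :: κ) = -X ^ a * signedMonomial R κ := by
  simp only [signedMonomial, List.length_cons, List.sum_cons]
  ring

lemma coeff_signedMonomial_of_ne {d : ℕ} {κ : List ℕ} (h : κ.sum ≠ d) :
    coeff d (signedMonomial R κ) = 0 := by
  rw [signedMonomial, ← map_one (C (R := R)), ← map_neg, ← map_pow, coeff_C_mul, coeff_X_pow,
    if_neg h.symm, mul_zero]

lemma X_pow_dvd_signedMonomial_cons {a : ℕ} {κ : List ℕ} :
    (X : R⟦X⟧) ^ a ∣ signedMonomial R (a :: κ) := by
  rw [signedMonomial_cons]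
  exact (dvd_neg.mpr dvd_rfl).mul_right _

variable [TopologicalSpace R]

lemma summable_indicator_signedMonomial {s : Set (List ℕ)} (hs : ∀ κ ∈ s, ∀ k ∈ κ, 1 ≤ k) :
    Summable (s.indicator (signedMonomial R)) := by
  refine summable_of_finite_coeff_ne_zero fun d => (finite_setOf_sum_eq d).subset fun κ hκ => ?_
  by_cases hm : κ ∈ s
  · refine ⟨hs κ hm, by_contra fun hd => hκ ?_⟩
    rw [Set.indicator_of_mem hm, coeff_signedMonomial_of_ne R hd]
  · exact absurd (by rw [Set.indicator_of_notMem hm, map_zero]) hκ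

variable {R}

lemma summable_slowWords {p : ℕ} (hp : 1 ≤ p) {s : Set (List ℕ)} (hs : s ⊆ slowWords p) :
    Summable (s.indicator (signedMonomial R)) :=
  summable_indicator_signedMonomial R fun _ hκ k hk => hp.trans ((hs hκ).1 k hk)

variable (R)

/-- The signed generating series of the slow words. -/
noncomputable def slowSeries (p : ℕ) : R⟦X⟧ :=
  ∑' κ, (slowWords p).indicator (signedMonomial R) κ

/-- The signed generating series of the slow words that are empty or begin with a letter at most
`a`. -/
noncomputable def slowSeriesLE (p a : ℕ) : R⟦X⟧ :=
  ∑' κ, (slowWords p ∩ headLE a).indicator (signedMonomial R) κ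

variable {R}

lemma slowSeriesLE_of_succ_eq {p a : ℕ} (h : a + 1 = p) : slowSeriesLE R p a = 1 := by
  have : slowWords p ∩ headLE a = {[]} := by
    ext κ
    rcases κ with _ | ⟨b, κ⟩
    · simp [nil_mem_slowWords, nil_mem_headLE]
    · simp only [Set.mem_inter_iff, cons_mem_slowWords, cons_mem_headLE, Set.mem_singleton_iff,
        reduceCtorEq, iff_false]
      omega
  rw [slowSeriesLE, this, tsum_eq_single [] fun κ hκ => Set.indicator_of_notMem (by simpa) _]
  simp [signedMonomial_nil]

variable [DiscreteTopology R]

/-- The two truncations differ by the words beginning with exactly `a+1`. Deleting that letter costs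
`-X^(a+1)` and leaves any admissible word whose head, if any, is at most `a+2`. -/
lemma slowSeriesLE_eq {p a : ℕ} (hp : 1 ≤ p) (ha : p ≤ a + 1) :
    slowSeriesLE R p a = slowSeriesLE R p (a + 1) + X ^ (a + 1) * slowSeriesLE R p (a + 2) := by
  have h1 : Summable ((slowWords p ∩ headLE a).indicator (signedMonomial R)) :=
    summable_slowWords hp Set.inter_subset_left
  have h2 : Summable ((slowWords p ∩ headLE (a + 1)).indicator (signedMonomial R)) :=
    summable_slowWords hp Set.inter_subset_left
  have h3 : Summable ((slowWords p ∩ headLE (a + 2)).indicator (signedMonomial R)) :=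
    summable_slowWords hp Set.inter_subset_left
  rw [← sub_eq_iff_eq_add']
  simp only [slowSeriesLE]
  rw [← h3.tsum_mul_left, ← h1.tsum_sub h2,
    -- Reindex along `κ ↦ (a+1) :: κ`, whose range contains the support of the difference.
    ← (List.cons_injective (a := a + 1)).tsum_eq]
  · refine tsum_congr fun κ => ?_
    rw [Set.indicator_of_notMem (s := slowWords p ∩ headLE a), zero_sub]
    · by_cases hκ : κ ∈ slowWords p ∩ headLE (a + 2)
      · rw [Set.indicator_of_mem hκ, Set.indicator_of_mem, signedMonomial_cons]
        · ring
        · exact ⟨cons_mem_slowWords.mpr ⟨ha, hκ⟩, cons_mem_headLE.mpr le_rfl⟩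
      · rw [Set.indicator_of_notMem hκ, Set.indicator_of_notMem]
        · simp
        · exact fun h => hκ (cons_mem_slowWords.mp h.1).2
    · exact fun h => absurd (cons_mem_headLE.mp h.2) (by omega)
  · intro κ hκ
    rcases κ with _ | ⟨b, κ⟩
    · refine absurd ?_ hκ
      beta_reduce
      rw [Set.indicator_of_mem, Set.indicator_of_mem, sub_self]
      · exact ⟨nil_mem_slowWords p, nil_mem_headLE _⟩
      · exact ⟨nil_mem_slowWords p, nil_mem_headLE _⟩
    · by_cases hb : b = a + 1
      · exact ⟨κ, by rw [hb]⟩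
      · refine absurd ?_ hκ
        have hiff : b :: κ ∈ slowWords p ∩ headLE a ↔ b :: κ ∈ slowWords p ∩ headLE (a + 1) := by
          simp only [Set.mem_inter_iff, cons_mem_headLE]
          exact and_congr_right fun _ => by omega
        beta_reduce
        by_cases hm : b :: κ ∈ slowWords p ∩ headLE a
        · rw [Set.indicator_of_mem hm, Set.indicator_of_mem (hiff.mp hm), sub_self]
        · rw [Set.indicator_of_notMem hm, Set.indicator_of_notMem (mt hiff.mpr hm), sub_self]

lemma X_pow_dvd_slowSeriesLE_sub {p : ℕ} (hp : 1 ≤ p) (a : ℕ) :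
    (X : R⟦X⟧) ^ a ∣ slowSeriesLE R p a - slowSeries R p := by
  have h1 : Summable ((slowWords p ∩ headLE a).indicator (signedMonomial R)) :=
    summable_slowWords hp Set.inter_subset_left
  have h2 : Summable ((slowWords p).indicator (signedMonomial R)) :=
    summable_slowWords hp subset_rfl
  rw [slowSeriesLE, slowSeries, ← h1.tsum_sub h2]
  refine X_pow_dvd_tsum fun κ => ?_
  by_cases hs : κ ∈ slowWords p
  · by_cases hh : κ ∈ headLE a
    · rw [Set.indicator_of_mem (Set.mem_inter hs hh), Set.indicator_of_mem hs, sub_self]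
      exact dvd_zero _
    · rw [Set.indicator_of_notMem fun h => hh h.2, Set.indicator_of_mem hs, zero_sub, dvd_neg]
      rcases κ with _ | ⟨b, κ⟩
      · exact absurd (nil_mem_headLE a) hh
      · rw [cons_mem_headLE, not_le] at hh
        exact (pow_dvd_pow X hh.le).trans (X_pow_dvd_signedMonomial_cons R)
  · rw [Set.indicator_of_notMem fun h => hs h.1, Set.indicator_of_notMem hs, sub_self]
    exact dvd_zero _

lemma tprod_one_sub_X_pow_eq_mul (n : ℕ) :
    ∏' i : ℕ, (1 - (X : R⟦X⟧) ^ (i + n + 1)) =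
      (1 - X ^ (n + 1)) * ∏' i : ℕ, (1 - (X : R⟦X⟧) ^ (i + (n + 1) + 1)) := by
  have hm : Multipliable fun i : ℕ => (1 : R⟦X⟧) - X ^ (i + 1 + n + 1) :=
    multipliable_one_sub_X_pow_of_lt fun i => by omega
  refine (tprod_eq_zero_mul' (f := fun i : ℕ => (1 : R⟦X⟧) - X ^ (i + n + 1)) hm).trans ?_
  rw [zero_add]
  exact congrArg _ (tprod_congr fun i => by rw [add_right_comm i 1 n, add_assoc i n 1])

/-- The series of slow words, times Selberg's series, in terms of the truncated series. -/
theorem tprod_mul_slowSeriesLE {p n : ℕ} (hp : 1 ≤ p) (hn : p ≤ n + 1) :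
    (∏' i : ℕ, (1 - (X : R⟦X⟧) ^ (i + n + 1))) * slowSeriesLE R p n =
      slowSeries R p * selbergSeries R 0 2 n := by
  refine sub_eq_zero.mp (eq_zero_of_backward_recurrence (n₀ := p - 1)
    (e := fun n => (∏' i : ℕ, (1 - (X : R⟦X⟧) ^ (i + n + 1))) * slowSeriesLE R p n -
      slowSeries R p * selbergSeries R 0 2 n)
    (a := fun n => 1 - X ^ (n + 1))
    (b := fun n => X ^ (n + 1) * (1 - X ^ (n + 1)) * (1 - X ^ (n + 2))) ?_ ?_ (by omega))
  · intro n hn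
    have hK : selbergSeries R 0 2 n = (1 - X ^ (n + 1)) * selbergSeries R 0 2 (n + 1) +
        X ^ (n + 1) * (1 - X ^ (n + 1)) * ((1 - X ^ (n + 2)) * selbergSeries R 0 2 (n + 2)) := by
      rw [selbergSeries_zero_two_sub, selbergSeries_one_one, selbergSeries_one_one]
    rw [hK, slowSeriesLE_eq hp (by omega), tprod_one_sub_X_pow_eq_mul n,
      tprod_one_sub_X_pow_eq_mul (n + 1)]
    ring
  · intro n
    have h1 : (X : R⟦X⟧) ^ n ∣ ∏' i : ℕ, (1 - (X : R⟦X⟧) ^ (i + n + 1)) - 1 :=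
      X_pow_dvd_tprod_sub_one (multipliable_one_sub_X_pow_of_lt fun i => by omega) fun i => by
        rw [sub_sub_cancel_left, dvd_neg]
        exact pow_dvd_pow X (by omega)
    have h2 := X_pow_dvd_slowSeriesLE_sub (R := R) hp n
    have h3 := X_pow_dvd_selbergSeries_sub_one (R := R) n
    generalize ∏' i : ℕ, (1 - (X : R⟦X⟧) ^ (i + n + 1)) = P at *
    rw [show P * slowSeriesLE R p n - slowSeries R p * selbergSeries R 0 2 n =
      (P - 1) * slowSeriesLE R p n + (slowSeriesLE R p n - slowSeries R p) -
        slowSeries R p * (selbergSeries R 0 2 n - 1) by ring]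
    exact dvd_sub (dvd_add (h1.mul_right _) h2) (h3.mul_left _)

end Words

/-! ### Umbral evaluations as signed sums over words -/

section Evaluation

variable (R : Type*) [CommRing R]

lemma umbralTerm_gradedSeries_one (L : Language ℕ) :
    umbralTerm (gradedSeries R L) 1 = Set.indicator {κ | κ ∈ L} (signedMonomial R) := by
  ext1 κ
  have h : (κ.map fun k => C (1 : R) * (X : R⟦X⟧) ^ k).prod = X ^ κ.sum := by
    induction κ with
    | nil => simp
    | cons a κ ih => simp [pow_add, ← ih]
  rw [umbralTerm, h]
  by_cases hκ : κ ∈ L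
  · rw [Set.indicator_of_mem (s := {κ | κ ∈ L}) hκ, gradedSeries, if_pos hκ, signedMonomial,
      smul_eq_C_mul]
    simp
  · rw [Set.indicator_of_notMem (s := {κ | κ ∈ L}) hκ, gradedSeries, if_neg hκ, zero_smul]

lemma umbralTerm_genSeries_neg_one (L : Language ℕ) :
    umbralTerm (genSeries R L) (-1) = Set.indicator {κ | κ ∈ L} (signedMonomial R) := by
  ext1 κ
  have h : (κ.map fun k => C (-1 : R) * (X : R⟦X⟧) ^ k).prod = signedMonomial R κ := by
    induction κ with
    | nil => simp [signedMonomial]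
    | cons a κ ih => rw [List.map_cons, List.prod_cons, ih, signedMonomial_cons]; simp
  rw [umbralTerm, h]
  by_cases hκ : κ ∈ L
  · rw [Set.indicator_of_mem (s := {κ | κ ∈ L}) hκ, genSeries, if_pos hκ, one_smul]
  · rw [Set.indicator_of_notMem (s := {κ | κ ∈ L}) hκ, genSeries, if_neg hκ, zero_smul]

lemma mem_risingCompositions_one {κ : List ℕ} : κ ∈ risingCompositions 1 ↔ κ ∈ slowWords 1 := by
  -- In `risingCompositions` the casts elaborate to a coercion of the whole list to `List ℤ`, in
  -- monadic form.
  have hcast : (do let a ← κ; pure (a : ℤ)) = κ.map (fun a : ℕ => (a : ℤ)) := by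
    simp [List.map_eq_flatMap]
  change _ ∧ List.IsChain _ (do let a ← κ; pure (a : ℤ)) ↔ _
  rw [hcast, List.isChain_map]
  refine and_congr_right fun _ => iff_of_eq (congrArg (fun r => List.IsChain r κ) ?_)
  funext a b
  rw [eq_iff_iff]
  push_cast
  omega

lemma mem_risingCompositions_one_and {κ : List ℕ} :
    (κ ∈ risingCompositions 1 ∧ ∀ k ∈ κ, 2 ≤ k) ↔ κ ∈ slowWords 2 := by
  rw [mem_risingCompositions_one]
  exact ⟨fun h => ⟨h.2, h.1.2⟩,
    fun h => ⟨⟨fun k hk => one_le_two.trans (h.1 k hk), h.2⟩, h.1⟩⟩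

lemma mem_shiftLanguage_risingCompositions_one {κ : List ℕ} :
    κ ∈ shiftLanguage (risingCompositions 1) ↔ κ ∈ slowWords 2 := by
  change (∃ l, l ∈ risingCompositions 1 ∧ l.map (fun i => i + 1) = κ) ↔ _
  constructor
  · rintro ⟨l, hl, rfl⟩
    rw [mem_risingCompositions_one] at hl
    refine ⟨?_, (List.isChain_map _).mpr (hl.2.imp fun a b h => by omega)⟩
    simpa using hl.1
  · intro h
    refine ⟨κ.map fun i => i - 1, mem_risingCompositions_one.mpr ⟨?_, ?_⟩, ?_⟩
    · simp only [List.forall_mem_map]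
      exact fun k hk => Nat.le_sub_of_add_le (h.1 k hk)
    · exact (List.isChain_map _).mpr (h.2.imp fun a b h => by omega)
    · rw [List.map_map]
      conv_rhs => rw [← List.map_id κ]
      refine List.map_congr_left fun k hk => ?_
      have := h.1 k hk
      simp only [Function.comp_apply, id]
      omega

variable [TopologicalSpace R]

lemma summable_subtype_signedMonomial {p : ℕ} (hp : 1 ≤ p) {P : List ℕ → Prop}
    (hP : ∀ κ, P κ ↔ κ ∈ slowWords p) :
    Summable fun κ : {κ : List ℕ // P κ ∧ κ ≠ []} => signedMonomial R κ.1 :=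
  summable_subtype_iff_indicator (s := {κ | P κ ∧ κ ≠ []}) |>.mpr
    (summable_slowWords hp fun κ h => (hP κ).mp h.1)

variable [DiscreteTopology R]

lemma one_add_tsum_subtype_signedMonomial {p : ℕ} (hp : 1 ≤ p) {P : List ℕ → Prop}
    (hP : ∀ κ, P κ ↔ κ ∈ slowWords p) :
    1 + ∑' κ : {κ : List ℕ // P κ ∧ κ ≠ []}, signedMonomial R κ.1 = slowSeries R p := by
  have hs : Summable ((slowWords p).indicator (signedMonomial R)) :=
    summable_slowWords hp subset_rfl
  rw [slowSeries, hs.tsum_eq_add_tsum_ite [], Set.indicator_of_mem (nil_mem_slowWords p),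
    signedMonomial_nil]
  refine congrArg _ ((tsum_subtype {κ | P κ ∧ κ ≠ []} (signedMonomial R)).trans
    (tsum_congr fun κ => ?_))
  by_cases h : κ = []
  · rw [if_pos h, Set.indicator_of_notMem fun hκ => hκ.2 h]
  · rw [if_neg h]
    exact Set.indicator_eq_indicator ((and_iff_left h).trans (hP κ)) rfl

end Evaluation

/-! ### Infinite products modulo five and the final cancellation -/

section Products

variable (R : Type*) [CommRing R] [TopologicalSpace R] [DiscreteTopology R]

lemma multipliable_rrFactor {a b : ℕ} (ha : 1 ≤ a) (hb : 1 ≤ b) : Multipliable (rrFactor R a b) :=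
  (multipliable_one_sub_X_pow_of_lt fun k => by omega).mul
    (multipliable_one_sub_X_pow_of_lt fun k => by omega)

/-- The constant coefficient is 1. This permits cancellation even when `R` has zero divisors. -/
lemma isUnit_tprod_mul_tprod_rrFactor {a b : ℕ} (ha : 1 ≤ a) (hb : 1 ≤ b) :
    IsUnit ((∏' k : ℕ, (1 - (X : R⟦X⟧) ^ (5 * k + 5))) * ∏' k, rrFactor R a b k) := by
  have m5 : Multipliable fun k : ℕ => (1 : R⟦X⟧) - X ^ (5 * k + 5) :=
    multipliable_one_sub_X_pow_of_lt fun k => by omega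
  rw [isUnit_iff_constantCoeff, map_mul, constantCoeff_tprod_eq_one m5,
    constantCoeff_tprod_eq_one (multipliable_rrFactor R ha hb), one_mul]
  · exact isUnit_one
  · intro k
    simp [rrFactor, show a ≠ 0 by omega, show b ≠ 0 by omega]
  · simp

lemma tprod_one_sub_X_pow_eq_mul_rrFactor :
    ∏' i : ℕ, (1 - (X : R⟦X⟧) ^ (i + 1)) = (∏' k : ℕ, (1 - (X : R⟦X⟧) ^ (5 * k + 5))) *
      (∏' k, rrFactor R 1 4 k) * ∏' k, rrFactor R 2 3 k := by
  have m1 : Multipliable fun i : ℕ => (1 : R⟦X⟧) - X ^ (i + 1) :=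
    multipliable_one_sub_X_pow_of_lt fun k => by omega
  have m5 : Multipliable fun k : ℕ => (1 : R⟦X⟧) - X ^ (5 * k + 5) :=
    multipliable_one_sub_X_pow_of_lt fun k => by omega
  have h5 : Tendsto (fun N : ℕ => 5 * N) atTop atTop :=
    tendsto_id.const_mul_atTop' (by norm_num)
  refine tendsto_nhds_unique (m1.tendsto_prod_tprod_nat.comp h5)
    (((m5.tendsto_prod_tprod_nat.mul
      (multipliable_rrFactor R le_rfl (by norm_num)).tendsto_prod_tprod_nat).mul
      (multipliable_rrFactor R (by norm_num) (by norm_num)).tendsto_prod_tprod_nat).congr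
      fun N => ?_)
  rw [Function.comp_apply]
  induction N with
  | zero => simp
  | succ N ih =>
    rw [mul_add, mul_one]
    rw [Finset.prod_range_add _ (5 * N) 5, ← ih, Finset.prod_range_succ, Finset.prod_range_succ,
      Finset.prod_range_succ]
    simp only [Finset.prod_range_succ, Finset.prod_range_zero, rrFactor]
    ring

/-- At `n = 0` every Gaussian binomial is `[r, r] = 1`, leaving a theta series: the triple product
with `a = 3`, `b = 2`. -/
lemma selbergSeries_zero_two_zero : selbergSeries R 0 2 0 =
    (∏' k : ℕ, (1 - (X : R⟦X⟧) ^ (5 * k + 5))) * ∏' k, rrFactor R 2 3 k := by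
  have h := tprod_mul_tprod_eq_tsum (R := R) (a := 3) (b := 2) rfl (by norm_num) (by norm_num)
  have hc : ∏' k : ℕ, ((1 - (X : R⟦X⟧) ^ (5 * k + 3)) * (1 - X ^ (5 * k + 2))) =
      ∏' k, rrFactor R 2 3 k := tprod_congr fun k => mul_comm _ _
  rw [← hc, h, selbergSeries]
  refine tsum_congr fun r => ?_
  rw [selbergTerm, zero_add, zero_add, gaussBinom_self, rrExponent_eq, Nat.choose_succ_succ' r 1,
    Nat.choose_one_right]
  ring

lemma selbergSeries_one_one_zero : selbergSeries R 1 1 0 =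
    (∏' k : ℕ, (1 - (X : R⟦X⟧) ^ (5 * k + 5))) * ∏' k, rrFactor R 1 4 k := by
  have h := tprod_mul_tprod_eq_tsum (R := R) (a := 4) (b := 1) rfl (by norm_num) (by norm_num)
  have hc : ∏' k : ℕ, ((1 - (X : R⟦X⟧) ^ (5 * k + 4)) * (1 - X ^ (5 * k + 1))) =
      ∏' k, rrFactor R 1 4 k := tprod_congr fun k => mul_comm _ _
  rw [← hc, h, selbergSeries]
  refine tsum_congr fun r => ?_
  rw [selbergTerm, zero_add, zero_add, gaussBinom_self, rrExponent_eq, Nat.choose_succ_succ' r 1,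
    Nat.choose_one_right]
  ring

theorem slowSeries_one : slowSeries R 1 = ∏' k, rrFactor R 1 4 k := by
  have h := tprod_mul_slowSeriesLE (R := R) (p := 1) (n := 0) le_rfl le_rfl
  rw [slowSeriesLE_of_succ_eq rfl, mul_one, selbergSeries_zero_two_zero] at h
  simp only [add_zero] at h
  rw [tprod_one_sub_X_pow_eq_mul_rrFactor] at h
  refine (isUnit_tprod_mul_tprod_rrFactor R (a := 2) (b := 3) (by norm_num)
    (by norm_num)).mul_right_cancel ?_
  rw [← h]
  ring

theorem slowSeries_two : slowSeries R 2 = ∏' k, rrFactor R 2 3 k := by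
  have h := tprod_mul_slowSeriesLE (R := R) (p := 2) (n := 1) (by norm_num) le_rfl
  have h0 := tprod_one_sub_X_pow_eq_mul (R := R) 0
  have h1 := selbergSeries_one_one (R := R) 0
  rw [slowSeriesLE_of_succ_eq rfl, mul_one] at h
  rw [selbergSeries_one_one_zero] at h1
  simp only [add_zero, zero_add] at h0 h1
  rw [tprod_one_sub_X_pow_eq_mul_rrFactor, h] at h0
  refine (isUnit_tprod_mul_tprod_rrFactor R (a := 1) (b := 4) (by norm_num)
    (by norm_num)).mul_right_cancel ?_
  -- The factor `1 - q` in `P_0 = (1 - q) P_1` turns `K_1` into `selbergSeries R 1 1 0`.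
  linear_combination slowSeries R 2 * h1 - h0

end Products

theorem mainTheorem3 (R : Type*) [CommRing R] [TopologicalSpace R] [DiscreteTopology R] :
    -- every infinite sum and product below converges (coefficientwise, unconditionally)
    (Multipliable (rrFactor R 1 4) ∧
      Summable (umbralTerm (genSeries R (risingCompositions 1)) (-1)) ∧
      Summable (umbralTerm (gradedSeries R (risingCompositions 1)) 1) ∧
      Summable (fun κ : {κ : List ℕ // κ ∈ risingCompositions 1 ∧ κ ≠ []} =>
        signedMonomial R κ.1)) ∧
    (Multipliable (rrFactor R 2 3) ∧
      Summable (umbralTerm (genSeries R (shiftLanguage (risingCompositions 1))) (-1)) ∧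
      Summable (umbralTerm (gradedSeries R (shiftLanguage (risingCompositions 1))) 1) ∧
      Summable (fun κ : {κ : List ℕ //
          (κ ∈ risingCompositions 1 ∧ ∀ k ∈ κ, 2 ≤ k) ∧ κ ≠ []} =>
        signedMonomial R κ.1)) ∧
    -- first identity: all compositions with risings at most one
    (umbralEval (genSeries R (risingCompositions 1)) (-1)
        = umbralEval (gradedSeries R (risingCompositions 1)) 1 ∧
      umbralEval (gradedSeries R (risingCompositions 1)) 1
        = 1 + ∑' κ : {κ : List ℕ // κ ∈ risingCompositions 1 ∧ κ ≠ []},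
            signedMonomial R κ.1 ∧
      1 + ∑' κ : {κ : List ℕ // κ ∈ risingCompositions 1 ∧ κ ≠ []},
            signedMonomial R κ.1
        = ∏' k : ℕ, rrFactor R 1 4 k) ∧
    -- second identity: those with all parts at least two
    (umbralEval (genSeries R (shiftLanguage (risingCompositions 1))) (-1)
        = umbralEval (gradedSeries R (shiftLanguage (risingCompositions 1))) 1 ∧
      umbralEval (gradedSeries R (shiftLanguage (risingCompositions 1))) 1
        = 1 + ∑' κ : {κ : List ℕ //
              (κ ∈ risingCompositions 1 ∧ ∀ k ∈ κ, 2 ≤ k) ∧ κ ≠ []},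
            signedMonomial R κ.1 ∧
      1 + ∑' κ : {κ : List ℕ //
              (κ ∈ risingCompositions 1 ∧ ∀ k ∈ κ, 2 ≤ k) ∧ κ ≠ []},
            signedMonomial R κ.1
        = ∏' k : ℕ, rrFactor R 2 3 k) := by
  have e1 : {κ | κ ∈ risingCompositions 1} = slowWords 1 :=
    Set.ext fun κ => mem_risingCompositions_one
  have e2 : {κ | κ ∈ shiftLanguage (risingCompositions 1)} = slowWords 2 :=
    Set.ext fun κ => mem_shiftLanguage_risingCompositions_one
  have hs1 : Summable ((slowWords 1).indicator (signedMonomial R)) :=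
    summable_slowWords le_rfl subset_rfl
  have hs2 : Summable ((slowWords 2).indicator (signedMonomial R)) :=
    summable_slowWords one_le_two subset_rfl
  have s1 := summable_subtype_signedMonomial R le_rfl fun κ =>
    mem_risingCompositions_one (κ := κ)
  have s2 := summable_subtype_signedMonomial R one_le_two fun κ =>
    mem_risingCompositions_one_and (κ := κ)
  have t1 := one_add_tsum_subtype_signedMonomial R le_rfl fun κ =>
    mem_risingCompositions_one (κ := κ)
  have t2 := one_add_tsum_subtype_signedMonomial R one_le_two fun κ =>
    mem_risingCompositions_one_and (κ := κ)
  simp only [umbralEval, umbralTerm_gradedSeries_one, umbralTerm_genSeries_neg_one, e1, e2]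
  exact ⟨⟨multipliable_rrFactor R (by norm_num) (by norm_num), hs1, hs1, s1⟩,
    ⟨multipliable_rrFactor R (by norm_num) (by norm_num), hs2, hs2, s2⟩,
    ⟨trivial, t1.symm, t1.trans (slowSeries_one R)⟩, ⟨trivial, t2.symm, t2.trans (slowSeries_two R)⟩⟩
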